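/- Let $K$ be a field, let $m<n$ be integers, and let $1\le \alpha_1<\alpha_2<\dots<\alpha_m=n$ with $m\ge 1$; put $\alpha_0=0$. Let $\mathcal K'$ be the graph on the vertices $v_1,\dots,v_n$ whose edges are those of the complete graph on $\{v_{\alpha_1},\dots,v_{\alpha_m}\}$ together with, for each $i=1,\dots,m$, the edges joining $v_{\alpha_i}$ to every $v_j$ with $\alpha_{i-1}<j<\alpha_i$ (a star with center $v_{\alpha_i}$), and which in addition has loops at an arbitrary set $\{v_{t_1},\dots,v_{t_l}\}$ of its vertices. Let $R=K[X_1,\dots,X_n]$ with the standard grading. Let $I(\mathcal K')\subset R$ be the edge ideal, generated by the $X_iX_j$ with $\{v_i,v_j\}$ an edge, $i\ne j$, and by the $X_i^2$ with a loop at $v_i$. Let $I_c(\mathcal K')\subset R$ be the ideal of vertex covers, generated by all monomials $X_{i_1}\cdots X_{i_r}$ with $i_1<\dots<i_r$ such that $(X_{i_1},\dots,X_{i_r})$ is an associated prime ideal of $I(\mathcal K')$. If $I_c(\mathcal K')$ is generated by a single monomial, then: 1. the projective dimension of $R/I_c(\mathcal K')$ over $R$ is $\mathrm{pd}_R(R/I_c(\mathcal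 K'))=1$; 2. the depth of $R/I_c(\mathcal K')$ with respect to the graded maximal ideal (the maximal length of an $R/I_c(\mathcal K')$-regular sequence in $(X_1,\dots,X_n)$) is $\mathrm{depth}_R(R/I_c(\mathcal K'))=n-1$; 3. the Krull dimension is $\dim_R(R/I_c(\mathcal K'))=n-1$; 4. the Castelnuovo–Mumford regularity (the maximum of $d-i$ over all $i$ and all degrees $d$ of basis elements of the $i$-th module of the minimal graded free resolution of $R/I_c(\mathcal K')$ over $R$) satisfies $\mathrm{reg}_R(R/I_c(\mathcal K'))\le n-1$. -/

import Mathlib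

open CategoryTheory

universe u

noncomputable section

/-- An (undirected) graph on the vertex set `V` in which loops are allowed: `edges` records the
edges joining distinct vertices, `loops` the vertices carrying a loop. -/
structure LoopGraph (V : Type) where
  /-- The edges `{v_i, v_j}` with `v_i ≠ v_j`. -/
  edges : SimpleGraph V
  /-- The vertices `v_i` such that the loop `{v_i, v_i}` is present. -/
  loops : Set V

/-- The edge ideal: generated by `X_i X_j` for the edges and by `X_i ^ 2` for the loops. -/
def LoopGraph.edgeIdeal {V : Type} (K : Type u) [Field K] (G : LoopGraph V) :
    Ideal (MvPolynomial V K) :=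
  Ideal.span ({f | ∃ i j, G.edges.Adj i j ∧ f = MvPolynomial.X i * MvPolynomial.X j} ∪
    {f | ∃ i ∈ G.loops, f = MvPolynomial.X i ^ 2})

/-- The ideal of vertex covers of the edge ideal: generated by the products `X_{i_1} ⋯ X_{i_r}`
(over finite sets `{i_1, …, i_r}` of vertices) such that the ideal `(X_{i_1}, …, X_{i_r})` is an
associated prime of the edge ideal `I`, that is, of the module `R ⧸ I`. -/
def LoopGraph.vertexCoverIdeal {V : Type} (K : Type u) [Field K] (G : LoopGraph V) :
    Ideal (MvPolynomial V K) :=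
  Ideal.span {f | ∃ C : Finset V,
    Ideal.span ((fun i => (MvPolynomial.X i : MvPolynomial V K)) '' (C : Set V)) ∈
      associatedPrimes (MvPolynomial V K) (MvPolynomial V K ⧸ G.edgeIdeal K) ∧
    f = ∏ i ∈ C, MvPolynomial.X i}

/-- The graph of `𝒦'`-type on the vertices `v_1, …, v_n` determined by
`0 = α_0 < α_1 < ⋯ < α_m = n` and a set of loops. The element `i : Fin n` stands for the vertex
`v_{i+1}`. The edges are those of the complete graph on `v_{α_1}, …, v_{α_m}`, together with those
joining `v_{α_i}` to each `v_j` with `α_{i-1} < j < α_i`, for `i = 1, …, m`. -/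
def kPrimeGraph (n m : ℕ) (α : Fin (m + 1) → ℕ) (loops : Set (Fin n)) : LoopGraph (Fin n) where
  edges := SimpleGraph.fromRel fun u v =>
    (∃ i j : Fin m, (u : ℕ) + 1 = α i.succ ∧ (v : ℕ) + 1 = α j.succ) ∨
    (∃ i : Fin m, α i.castSucc < (u : ℕ) + 1 ∧ (u : ℕ) + 1 < α i.succ ∧ (v : ℕ) + 1 = α i.succ)
  loops := loops

/-- The depth of the `R`-module `M` with respect to the ideal `J`: the supremum of the lengths of
the `M`-regular sequences consisting of elements of `J`. -/
def moduleDepth {R : Type*} [CommRing R] (J : Ideal R) (M : Type*) [AddCommGroup M] [Module R M] :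
    ℕ∞ :=
  ⨆ (rs : List R) (_ : (∀ r ∈ rs, r ∈ J) ∧ RingTheory.Sequence.IsRegular M rs), (rs.length : ℕ∞)

/-- The graded maximal ideal `(X_1, …, X_n)` of `K[X_1, …, X_n]`. -/
def gradedMaximalIdeal (K : Type u) [Field K] (n : ℕ) : Ideal (MvPolynomial (Fin n) K) :=
  Ideal.span (Set.range MvPolynomial.X)

/-- The standard `ℤ`-grading of `K[X_1, …, X_n]`, with `deg X_i = 1`. -/
def polyGrading (K : Type u) [Field K] (n : ℕ) (j : ℤ) : Submodule K (MvPolynomial (Fin n) K) :=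
  if 0 ≤ j then MvPolynomial.homogeneousSubmodule (Fin n) K j.toNat else ⊥

/-- The grading of `K[X_1, …, X_n] ⧸ I` induced by the standard grading (for homogeneous `I`). -/
def quotientGrading {K : Type u} [Field K] {n : ℕ} (I : Ideal (MvPolynomial (Fin n) K)) (j : ℤ) :
    AddSubgroup (MvPolynomial (Fin n) K ⧸ I) :=
  (polyGrading K n j).toAddSubgroup.map (Ideal.Quotient.mk I).toAddMonoidHom

/-- A minimal graded free resolution
`⋯ → F_2 → F_1 → F_0 → M → 0` of a graded module `M` over `R = K[X_1, …, X_n]`, with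
`F_i = ⨁_k R(-d_{i,k})` of finite rank; `shift i k` is `d_{i,k}`, the degree of the `k`-th basis
vector of `F_i`. All maps are homogeneous of degree `0`. -/
structure MinimalGradedFreeResolution {K : Type u} [Field K] {n : ℕ} (M : Type u)
    [AddCommGroup M] [Module (MvPolynomial (Fin n) K) M] (grading : ℤ → AddSubgroup M) where
  rank : ℕ → ℕ
  shift : (i : ℕ) → Fin (rank i) → ℤ
  diff : (i : ℕ) → (Fin (rank (i + 1)) → MvPolynomial (Fin n) K) →ₗ[MvPolynomial (Fin n) K]
    (Fin (rank i) → MvPolynomial (Fin n) K)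
  aug : (Fin (rank 0) → MvPolynomial (Fin n) K) →ₗ[MvPolynomial (Fin n) K] M
  diff_homogeneous : ∀ i k l,
    diff i (Pi.single k 1) l ∈ polyGrading K n (shift (i + 1) k - shift i l)
  aug_homogeneous : ∀ k, aug (Pi.single k 1) ∈ grading (shift 0 k)
  aug_surjective : Function.Surjective aug
  exact_aug : Function.Exact (diff 0) aug
  exact : ∀ i, Function.Exact (diff (i + 1)) (diff i)
  /-- Minimality: the matrices of the differentials have entries in `(X_1, …, X_n)`. -/
  minimal : ∀ i k l, diff i (Pi.single k 1) l ∈ gradedMaximalIdeal K n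

/-- The Castelnuovo–Mumford regularity of a graded module: the supremum of `d_{i,k} - i` over the
degrees `d_{i,k}` of the basis vectors of `F_i` in the minimal graded free resolution `F`. That
resolution is unique up to isomorphism, so the outer infimum only serves to pick it (and the
value is `⊤` if there is none). -/
def castelnuovoMumfordRegularity {K : Type u} [Field K] {n : ℕ} (M : Type u)
    [AddCommGroup M] [Module (MvPolynomial (Fin n) K) M] (grading : ℤ → AddSubgroup M) : EReal :=
  ⨅ F : MinimalGradedFreeResolution (K := K) (n := n) M grading,
    ⨆ (i : ℕ) (k : Fin (F.rank i)), (((F.shift i k - (i : ℤ) : ℤ) : ℝ) : EReal)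

end

/-!
An associated prime of `R ⧸ I(𝒦')` contains `I(𝒦')`, which is nonzero because `m < n` forces a
star edge; so every generator of the ideal of vertex covers is a squarefree monomial of positive
degree. If that ideal is principal, generated by a monomial `f`, then `f` lies in the graded
maximal ideal, and it divides a squarefree monomial, so that `1 ≤ deg f ≤ n`.

Everything else holds for every hypersurface ring `R ⧸ (f)` of this kind. The resolution
`0 → R(-deg f) → R → R ⧸ (f) → 0` gives the projective dimension (`R ⧸ (f)` is a nonzero torsion
module, so it is not projective) and the regularity `deg f - 1`. For the depth, fix a variable
`X_c`: the linear forms `X_j - X_c`, `j ≠ c`, generate successively the kernels of the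
homomorphisms identifying the `X_j` with `X_c`. These kernels are prime and contain no monomial,
which makes the linear forms a regular sequence on `R ⧸ (f)`, of length `n - 1`
(`isWeaklyRegular_quotient_span_singleton`). Conversely a regular sequence is never longer than
the Krull dimension (`length_le_supportDim_of_isRegular`), which is at most `n - 1` because `f` is
a nonzerodivisor. Hence depth and dimension both equal `n - 1`.
-/

open MvPolynomial RingTheory.Sequence

/-! ### Regular sequences and Krull dimension -/

/-- A regular sequence on a finite module over a Noetherian ring, not assumed local, is at most
as long as the dimension of the module. -/
lemma length_le_supportDim_of_isRegular {R : Type*} [CommRing R] [IsNoetherianRing R]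
    (rs : List R) (M : Type*) [AddCommGroup M] [Module R M] [Module.Finite R M]
    (h : IsRegular M rs) : (rs.length : WithBot ℕ∞) ≤ Module.supportDim R M := by
  induction rs generalizing M with
  | nil =>
    have : Nontrivial M := by
      rw [← not_subsingleton_iff_nontrivial]
      exact fun _ => h.top_ne_smul (Subsingleton.elim _ _)
    have hne := Module.supportDim_ne_bot_of_nontrivial R M
    rw [List.length_nil, ← WithBot.coe_unbot _ hne]
    exact WithBot.coe_le_coe.mpr zero_le
  | cons r rs ih =>
    rw [isRegular_cons_iff] at h
    have h1 := ih (QuotSMulTop r M) h.2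
    have h2 := Module.supportDim_quotSMulTop_succ_le_of_notMem_minimalPrimes
      (R := R) (M := M) (x := r) fun _ => h.1.notMem_of_mem_minimalPrimes
    refine le_trans ?_ h2
    push_cast [List.length_cons]
    gcongr

lemma mk_mem_smul_top_iff {R : Type*} [CommRing R] (I J : Ideal R) (a : R) :
    (Submodule.Quotient.mk a : R ⧸ I) ∈ (J • ⊤ : Submodule R (R ⧸ I)) ↔ a ∈ I ⊔ J := by
  have h : (J • ⊤ : Submodule R (R ⧸ I)) = Submodule.map I.mkQ J := by
    rw [← Submodule.range_mkQ I, ← Submodule.map_top, ← Submodule.map_smul'']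
    simp
  rw [h, ← Submodule.comap_map_mkQ]
  rfl

/-- If the ideals generated by the initial segments of `rs` are prime and strictly increasing,
and `f` lies in none of them, then `rs` is weakly regular on `R ⧸ (f)`. -/
lemma isWeaklyRegular_quotient_span_singleton {R : Type*} [CommRing R] (f : R) (rs : List R)
    (hprime : ∀ i, (Ideal.ofList (rs.take i)).IsPrime) (hf : f ∉ Ideal.ofList rs)
    (hrs : ∀ i (h : i < rs.length), rs[i] ∉ Ideal.ofList (rs.take i)) :
    IsWeaklyRegular (R ⧸ Ideal.span {f}) rs := by
  refine ⟨fun i hi => ?_⟩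
  set J := Ideal.ofList (rs.take i) with hJ
  set r := rs[i]
  have hsucc : Ideal.ofList (rs.take (i + 1)) = J ⊔ Ideal.span {r} := by
    rw [← List.take_concat_get' rs i hi, Ideal.ofList_append, Ideal.ofList_singleton]
  have hf' : f ∉ J ⊔ Ideal.span {r} := by
    rw [← hsucc]
    exact fun h => hf (Ideal.span_mono (fun x hx => List.mem_of_mem_take hx) h)
  have hJr : (J ⊔ Ideal.span {r}).IsPrime := hsucc ▸ hprime (i + 1)
  rw [isSMulRegular_quotient_iff_mem_of_smul_mem]
  intro x hx
  obtain ⟨a, rfl⟩ := Submodule.Quotient.mk_surjective _ x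
  rw [← Submodule.Quotient.mk_smul] at hx
  rw [mk_mem_smul_top_iff] at hx ⊢
  -- `r a = f b + j` puts `b` into the prime `J + (r)`; writing `b = j' + r c` leaves
  -- `r (a - f c) ∈ J`.
  obtain ⟨y, hy, j, hj, hyj⟩ := Submodule.mem_sup.mp hx
  obtain ⟨b, rfl⟩ := Ideal.mem_span_singleton'.mp hy
  have hb : b ∈ J ⊔ Ideal.span {r} := by
    refine (hJr.mem_or_mem (x := b) (y := f) ?_).resolve_right hf'
    have : b * f = r * a - j := by rw [← smul_eq_mul r a, ← hyj]; ring
    rw [this]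
    exact sub_mem (Ideal.mul_mem_right _ _
      (Ideal.mem_sup_right (Ideal.mem_span_singleton_self r))) (Ideal.mem_sup_left hj)
  obtain ⟨j', hj', z, hz, rfl⟩ := Submodule.mem_sup.mp hb
  obtain ⟨c, rfl⟩ := Ideal.mem_span_singleton'.mp hz
  have hac : r * (a - c * f) ∈ J := by
    have : r * (a - c * f) = j' * f + j := by
      rw [mul_sub, ← smul_eq_mul r a, ← hyj]; ring
    rw [this]
    exact add_mem (Ideal.mul_mem_right _ _ hj') hj
  have := ((hprime i).mem_or_mem hac).resolve_left (hrs i hi)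
  rw [← sub_add_cancel a (c * f)]
  exact add_mem (Ideal.mem_sup_right this)
    (Ideal.mem_sup_left (Ideal.mul_mem_left _ _ (Ideal.mem_span_singleton_self f)))

/-! ### Identifying variables -/

section IdentifyVars

variable {σ K : Type*} [DecidableEq σ] [Field K]

/-- The endomorphism of the polynomial ring replacing the variables listed in `L` by `X c`. -/
noncomputable def identifyVars (K : Type*) [Field K] (c : σ) (L : List σ) :
    MvPolynomial σ K →ₐ[K] MvPolynomial σ K :=
  aeval fun j => if j ∈ L then X c else X j

lemma ofList_map_X_sub_X (c : σ) (L : List σ) :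
    Ideal.ofList (L.map fun j => (X j - X c : MvPolynomial σ K)) =
      RingHom.ker (identifyVars K c L) := by
  set J := Ideal.ofList (L.map fun j => (X j - X c : MvPolynomial σ K)) with hJ
  have hmem : ∀ j ∈ L, (X j - X c : MvPolynomial σ K) ∈ J := fun j hj =>
    Ideal.subset_span (List.mem_map.mpr ⟨j, hj, rfl⟩)
  apply le_antisymm
  · rw [hJ, Ideal.ofList, Ideal.span_le]
    intro p hp
    obtain ⟨j, hj, rfl⟩ := List.mem_map.mp hp
    simp [identifyVars, hj, RingHom.mem_ker]
  · -- Modulo `J`, identifying the variables changes nothing.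
    have hcomp : (Ideal.Quotient.mkₐ K J).comp (identifyVars K c L) =
        Ideal.Quotient.mkₐ K J := by
      apply MvPolynomial.algHom_ext
      intro j
      by_cases hj : j ∈ L
      · simp only [AlgHom.comp_apply, identifyVars, aeval_X, if_pos hj]
        exact ((Ideal.Quotient.mk_eq_mk_iff_sub_mem _ _).mpr (hmem j hj)).symm
      · simp [identifyVars, hj]
    intro p hp
    rw [RingHom.mem_ker] at hp
    have := DFunLike.congr_fun hcomp p
    rw [AlgHom.comp_apply, hp, map_zero] at this
    exact Ideal.Quotient.eq_zero_iff_mem.mp this.symm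

lemma identifyVars_monomial_ne_zero (c : σ) (L : List σ) (s : σ →₀ ℕ) :
    identifyVars K c L (monomial s 1) ≠ 0 := by
  rw [identifyVars, aeval_monomial, map_one, one_mul]
  refine Finset.prod_ne_zero_iff.mpr fun i _ => pow_ne_zero _ ?_
  split_ifs <;> exact X_ne_zero _

lemma isWeaklyRegular_X_sub_X (c : σ) (s : σ →₀ ℕ) (L : List σ) (hL : L.Nodup) (hc : c ∉ L) :
    IsWeaklyRegular (MvPolynomial σ K ⧸ Ideal.span {(monomial s 1 : MvPolynomial σ K)})
      (L.map fun j => (X j - X c : MvPolynomial σ K)) := by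
  apply isWeaklyRegular_quotient_span_singleton
  · intro i
    rw [← List.map_take, ofList_map_X_sub_X]
    exact RingHom.ker_isPrime _
  · rw [ofList_map_X_sub_X, RingHom.mem_ker]
    exact identifyVars_monomial_ne_zero c L s
  · intro i hi
    rw [List.length_map] at hi
    rw [← List.map_take, ofList_map_X_sub_X, RingHom.mem_ker, List.getElem_map]
    have h1 : L[i] ∉ L.take i := by
      intro h
      obtain ⟨k, hk, hki⟩ := List.getElem_of_mem h
      rw [List.getElem_take] at hki
      have := (hL.getElem_inj_iff).mp hki
      rw [List.length_take] at hk
      omega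
    have h2 : c ∉ L.take i := fun h => hc (List.mem_of_mem_take h)
    have h3 : L[i] ≠ c := fun h => hc (h ▸ List.getElem_mem hi)
    simp only [identifyVars, map_sub, aeval_X, if_neg h1, if_neg h2]
    exact sub_ne_zero.mpr fun h => h3 (X_injective h)

end IdentifyVars

/-! ### Projective dimension of a hypersurface -/

lemma projectiveDimension_quotient_span_singleton {R : Type u} [CommRing R] [IsDomain R] (f : R)
    (hf : f ≠ 0) (hf' : Ideal.span {f} ≠ ⊤) :
    projectiveDimension (ModuleCat.of R (R ⧸ Ideal.span {f})) = 1 := by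
  have : Nontrivial (R ⧸ Ideal.span {f}) := Ideal.Quotient.nontrivial_iff.mpr hf'
  apply le_antisymm
  · have hS := LinearMap.shortExact_shortComplexKer (f := (Ideal.span {f}).mkQ)
      (Submodule.mkQ_surjective _)
    have hfree : Module.Projective R (LinearMap.ker (Ideal.span {f}).mkQ) := by
      rw [Submodule.ker_mkQ]
      exact Module.Projective.of_equiv (LinearEquiv.toSpanNonzeroSingleton R R f hf)
    have h1 : Projective (Ideal.span {f}).mkQ.shortComplexKer.X₁ :=
      (IsProjective.iff_projective _).mp hfree
    have h2 : Projective (Ideal.span {f}).mkQ.shortComplexKer.X₂ :=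
      (IsProjective.iff_projective R).mp inferInstance
    have h3 : HasProjectiveDimensionLT (Ideal.span {f}).mkQ.shortComplexKer.X₃ 2 :=
      (hS.hasProjectiveDimensionLT_X₃_iff 0 h2).mpr inferInstance
    exact (projectiveDimension_le_iff _ 1).mpr h3
  · refine (projectiveDimension_ge_iff _ 1).mpr fun h => ?_
    have h1 : Projective (ModuleCat.of R (R ⧸ Ideal.span {f})) :=
      projective_iff_hasProjectiveDimensionLT_one.mpr h
    have h2 : Module.Projective R (R ⧸ Ideal.span {f}) := (IsProjective.iff_projective _).mpr h1
    -- A projective module over a domain is torsion-free, but `f` annihilates the class of `1`.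
    have h3 : f • (1 : R ⧸ Ideal.span {f}) = 0 := by
      rw [Algebra.smul_def, mul_one]
      exact Ideal.Quotient.eq_zero_iff_mem.mpr (Ideal.mem_span_singleton_self f)
    rcases smul_eq_zero.mp h3 with h | h
    · exact hf h
    · exact one_ne_zero h

/-! ### Depth, dimension and regularity of a monomial hypersurface -/

section MonomialHypersurface

variable (K : Type u) [Field K] {n : ℕ}

lemma gradedMaximalIdeal_ne_top (n : ℕ) : gradedMaximalIdeal K n ≠ ⊤ := by
  intro h
  have hle : gradedMaximalIdeal K n ≤ RingHom.ker (constantCoeff (σ := Fin n) (R := K)) := by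
    rw [gradedMaximalIdeal, Ideal.span_le]
    rintro _ ⟨i, rfl⟩
    simp [RingHom.mem_ker]
  rw [h, top_le_iff] at hle
  exact RingHom.ker_ne_top _ hle

lemma exists_isRegular_length_eq (hn : 0 < n) (s : Fin n →₀ ℕ)
    (hs : (monomial s 1 : MvPolynomial (Fin n) K) ∈ gradedMaximalIdeal K n) :
    ∃ rs : List (MvPolynomial (Fin n) K), (∀ r ∈ rs, r ∈ gradedMaximalIdeal K n) ∧
      IsRegular (MvPolynomial (Fin n) K ⧸ Ideal.span {(monomial s 1 : MvPolynomial (Fin n) K)})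
        rs ∧ rs.length = n - 1 := by
  let c : Fin n := ⟨0, hn⟩
  let L := (Finset.univ.erase c).toList
  have hX : ∀ i : Fin n, (X i : MvPolynomial (Fin n) K) ∈ gradedMaximalIdeal K n := fun i =>
    Ideal.subset_span ⟨i, rfl⟩
  have hmem : ∀ r ∈ L.map (fun j => (X j - X c : MvPolynomial (Fin n) K)),
      r ∈ gradedMaximalIdeal K n := by
    intro r hr
    obtain ⟨j, -, rfl⟩ := List.mem_map.mp hr
    exact sub_mem (hX j) (hX c)
  refine ⟨_, hmem, ⟨isWeaklyRegular_X_sub_X c s L (Finset.nodup_toList _) (by simp [L]), ?_⟩, ?_⟩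
  · intro htop
    apply gradedMaximalIdeal_ne_top K n
    have h1 := (mk_mem_smul_top_iff _ _ _).mp
      (htop ▸ Submodule.mem_top (x := Submodule.Quotient.mk (1 : MvPolynomial (Fin n) K)))
    refine (Ideal.eq_top_iff_one _).mpr ((sup_le ?_ ?_ : _ ≤ gradedMaximalIdeal K n) h1)
    · rwa [Ideal.span_singleton_le_iff_mem]
    · exact Ideal.span_le.mpr hmem
  · simp [L]

lemma ringKrullDim_quotient_monomial_le (hn : 0 < n) (s : Fin n →₀ ℕ) :
    ringKrullDim (MvPolynomial (Fin n) K ⧸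
      Ideal.span {(monomial s 1 : MvPolynomial (Fin n) K)}) ≤ ((n - 1 : ℕ) : WithBot ℕ∞) := by
  have h := ringKrullDim_quotient_succ_le_of_nonZeroDivisor
    (mem_nonZeroDivisors_of_ne_zero
      (monomial_eq_zero.not.mpr one_ne_zero : (monomial s 1 : MvPolynomial (Fin n) K) ≠ 0))
  rw [MvPolynomial.ringKrullDim_of_isNoetherianRing, ringKrullDim_eq_zero_of_field, zero_add,
    Nat.card_fin] at h
  obtain ⟨k, rfl⟩ : ∃ k, n = k + 1 := ⟨n - 1, by omega⟩
  rw [Nat.add_sub_cancel]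
  push_cast at h
  exact (ENat.WithBot.add_le_add_one_right_iff).mp h

lemma moduleDepth_quotient_monomial (hn : 0 < n) (s : Fin n →₀ ℕ)
    (hs : (monomial s 1 : MvPolynomial (Fin n) K) ∈ gradedMaximalIdeal K n) :
    moduleDepth (gradedMaximalIdeal K n) (MvPolynomial (Fin n) K ⧸
      Ideal.span {(monomial s 1 : MvPolynomial (Fin n) K)}) = ((n - 1 : ℕ) : ℕ∞) := by
  apply le_antisymm
  · refine iSup₂_le fun rs hrs => ?_
    have h := (length_le_supportDim_of_isRegular rs _ hrs.2).trans
      ((Module.supportDim_quotient_eq_ringKrullDim _).trans_le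
        (ringKrullDim_quotient_monomial_le K hn s))
    exact_mod_cast h
  · obtain ⟨rs, h1, h2, h3⟩ := exists_isRegular_length_eq K hn s hs
    rw [← h3]
    exact le_iSup₂_of_le rs ⟨h1, h2⟩ le_rfl

lemma ringKrullDim_quotient_monomial (hn : 0 < n) (s : Fin n →₀ ℕ)
    (hs : (monomial s 1 : MvPolynomial (Fin n) K) ∈ gradedMaximalIdeal K n) :
    ringKrullDim (MvPolynomial (Fin n) K ⧸
      Ideal.span {(monomial s 1 : MvPolynomial (Fin n) K)}) = ((n - 1 : ℕ) : WithBot ℕ∞) := by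
  apply le_antisymm (ringKrullDim_quotient_monomial_le K hn s)
  obtain ⟨rs, -, h2, h3⟩ := exists_isRegular_length_eq K hn s hs
  rw [← h3, ← Module.supportDim_quotient_eq_ringKrullDim]
  exact length_le_supportDim_of_isRegular rs _ h2

/-- The minimal graded free resolution `0 → R(-d) → R → R ⧸ (f) → 0` of a hypersurface ring, where
`f ≠ 0` is homogeneous of degree `d` and lies in the graded maximal ideal. -/
noncomputable def hypersurfaceResolution (f : MvPolynomial (Fin n) K) (d : ℕ) (hf : f ≠ 0)
    (hd : f.IsHomogeneous d) (hm : f ∈ gradedMaximalIdeal K n) :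
    MinimalGradedFreeResolution (K := K) (n := n) (MvPolynomial (Fin n) K ⧸ Ideal.span {f})
      (quotientGrading (Ideal.span {f})) where
  rank
    | 0 => 1
    | 1 => 1
    | _ + 2 => 0
  shift
    | 0 => fun _ => 0
    | 1 => fun _ => d
    | _ + 2 => fun _ => 0
  diff
    | 0 => f • LinearMap.id
    | _ + 1 => 0
  aug := (Ideal.span {f}).mkQ ∘ₗ LinearMap.proj 0
  diff_homogeneous
    | 0, k, l => by
      have hkl : l = k := Subsingleton.elim (α := Fin 1) _ _
      subst hkl
      simpa [polyGrading] using hd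
    | _ + 1, _, _ => by simp
  aug_homogeneous k := by
    have hk : k = 0 := Subsingleton.elim (α := Fin 1) _ _
    subst hk
    refine ⟨1, ?_, ?_⟩
    · rw [polyGrading, if_pos le_rfl]
      exact isHomogeneous_one (Fin n) K
    · simp
  aug_surjective x := by
    obtain ⟨a, rfl⟩ := Submodule.Quotient.mk_surjective _ x
    exact ⟨fun _ => a, rfl⟩
  exact_aug x := by
    change Submodule.Quotient.mk (x 0) = 0 ↔ _
    rw [Submodule.Quotient.mk_eq_zero, Ideal.mem_span_singleton']
    constructor
    · rintro ⟨a, ha⟩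
      refine ⟨fun _ => a, funext fun (i : Fin 1) => ?_⟩
      rw [Subsingleton.elim i 0, ← ha]
      exact mul_comm f a
    · rintro ⟨y, rfl⟩
      exact ⟨y 0, mul_comm _ _⟩
  exact
    | 0 => fun x => by
      constructor
      · intro hx
        refine ⟨0, ?_⟩
        rw [map_zero]
        exact ((smul_eq_zero.mp hx).resolve_left hf).symm
      · rintro ⟨y, rfl⟩
        simp
    | _ + 1 => fun x => ⟨fun _ => ⟨0, funext fun i => i.elim0⟩, fun _ => rfl⟩
  minimal
    | 0, k, l => by
      have hkl : l = k := Subsingleton.elim (α := Fin 1) _ _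
      subst hkl
      simpa using hm
    | _ + 1, _, _ => by simp

lemma castelnuovoMumfordRegularity_hypersurface_le (hn : 0 < n) (f : MvPolynomial (Fin n) K)
    (d : ℕ) (hf : f ≠ 0) (hd : f.IsHomogeneous d) (hm : f ∈ gradedMaximalIdeal K n)
    (hdn : d ≤ n) :
    castelnuovoMumfordRegularity (K := K) (n := n) (MvPolynomial (Fin n) K ⧸ Ideal.span {f})
      (quotientGrading (Ideal.span {f})) ≤ ((n - 1 : ℕ) : EReal) := by
  refine iInf_le_of_le (hypersurfaceResolution K f d hf hd hm) (iSup₂_le fun i k => ?_)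
  have hcast : ((n - 1 : ℕ) : EReal) = ((((n - 1 : ℕ) : ℤ) : ℝ) : EReal) := by simp
  rw [hcast, EReal.coe_le_coe_iff, Int.cast_le]
  match i, k with
  | 0, _ => simp [hypersurfaceResolution]
  | 1, _ =>
    simp only [hypersurfaceResolution]
    omega
  | i + 2, k => exact Fin.elim0 k

end MonomialHypersurface

/-! ### The generators of the ideal of vertex covers -/

/-- If the edge ideal is nonzero, the zero ideal is not an associated prime, so the constant `1`
does not occur among the generators of the ideal of vertex covers. -/
lemma nonempty_of_span_mem_associatedPrimes {V : Type} (K : Type u) [Field K] (G : LoopGraph V)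
    {u v : V} (huv : G.edges.Adj u v) (C : Finset V)
    (hC : Ideal.span ((fun i => (X i : MvPolynomial V K)) '' (C : Set V)) ∈
      associatedPrimes (MvPolynomial V K) (MvPolynomial V K ⧸ G.edgeIdeal K)) :
    C.Nonempty := by
  rw [Finset.nonempty_iff_ne_empty]
  rintro rfl
  have hle := IsAssociatedPrime.annihilator_le hC
  have hmem : (X u * X v : MvPolynomial V K) ∈ G.edgeIdeal K :=
    Ideal.subset_span (Or.inl ⟨u, v, huv, rfl⟩)
  rw [Submodule.annihilator_top, Ideal.annihilator_quotient] at hle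
  have := hle hmem
  simp at this

lemma vertexCoverIdeal_le_gradedMaximalIdeal (K : Type u) [Field K] {n : ℕ}
    (G : LoopGraph (Fin n)) {u v : Fin n} (huv : G.edges.Adj u v) :
    G.vertexCoverIdeal K ≤ gradedMaximalIdeal K n := by
  rw [LoopGraph.vertexCoverIdeal, Ideal.span_le]
  rintro _ ⟨C, hC, rfl⟩
  obtain ⟨i, hi⟩ := nonempty_of_span_mem_associatedPrimes K G huv C hC
  exact Ideal.mem_of_dvd _ (Finset.dvd_prod_of_mem _ hi) (Ideal.subset_span ⟨i, rfl⟩)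

/-- A monomial generating the whole ideal of vertex covers divides a squarefree monomial. -/
lemma degree_le_of_vertexCoverIdeal_eq_span (K : Type u) [Field K] {n : ℕ}
    (G : LoopGraph (Fin n)) (s : Fin n →₀ ℕ)
    (hs : G.vertexCoverIdeal K = Ideal.span {monomial s (1 : K)}) : s.degree ≤ n := by
  have hne : (monomial s 1 : MvPolynomial (Fin n) K) ≠ 0 :=
    monomial_eq_zero.not.mpr one_ne_zero
  obtain ⟨C, hC⟩ : ∃ C : Finset (Fin n),
      (∏ i ∈ C, X i : MvPolynomial (Fin n) K) ∈ G.vertexCoverIdeal K := by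
    by_contra! h
    refine hne ?_
    have hbot : G.vertexCoverIdeal K = ⊥ := by
      refine Ideal.span_eq_bot.mpr ?_
      rintro _ ⟨C, hC, rfl⟩
      refine absurd ?_ (h C)
      exact Ideal.subset_span ⟨C, hC, rfl⟩
    rw [hbot] at hs
    exact Ideal.span_singleton_eq_bot.mp hs.symm
  rw [hs, Ideal.mem_span_singleton] at hC
  obtain ⟨b, hb⟩ := hC
  have hprod : (∏ i ∈ C, X i : MvPolynomial (Fin n) K) ≠ 0 :=
    Finset.prod_ne_zero_iff.mpr fun i _ => X_ne_zero i
  have hb0 : b ≠ 0 := fun h => hprod (by rw [hb, h, mul_zero])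
  have hdeg : (∏ i ∈ C, X i : MvPolynomial (Fin n) K).totalDegree ≤ C.card := by
    refine (totalDegree_finsetProd _ _).trans ?_
    simp
  rw [hb, totalDegree_mul_of_isDomain hne hb0, totalDegree_monomial s one_ne_zero] at hdeg
  have hcard : C.card ≤ n := by simpa using Finset.card_le_univ C
  have : s.degree = s.sum fun _ e => e := rfl
  omega

/-- Since `m < n`, some gap `α_{i-1} < j < α_i` is nonempty, and its star contributes an edge. -/
lemma exists_adj_kPrimeGraph (n m : ℕ) (hmn : m < n) (α : Fin (m + 1) → ℕ)
    (hα : StrictMono α) (hα_zero : α 0 = 0) (hα_last : α (Fin.last m) = n)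
    (loops : Set (Fin n)) : ∃ u v : Fin n, (kPrimeGraph n m α loops).edges.Adj u v := by
  obtain ⟨i, hi⟩ : ∃ i : Fin m, α i.castSucc + 1 < α i.succ := by
    by_contra! h
    have hval : ∀ k : Fin (m + 1), α k ≤ k := by
      intro k
      induction k using Fin.induction with
      | zero => simp [hα_zero]
      | succ i ih =>
        have := h i
        simp only [Fin.val_castSucc, Fin.val_succ] at ih ⊢
        omega
    have := hval (Fin.last m)
    rw [hα_last, Fin.val_last] at this
    omega
  have hle : α i.succ ≤ n := (hα.monotone (Fin.le_last _)).trans_eq hα_last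
  refine ⟨⟨α i.castSucc, by omega⟩, ⟨α i.succ - 1, by omega⟩, ?_⟩
  rw [kPrimeGraph, SimpleGraph.fromRel_adj]
  refine ⟨fun h => ?_, Or.inl (Or.inr ⟨i, ?_, ?_, ?_⟩)⟩
  · have := congrArg Fin.val h
    simp only at this
    omega
  all_goals simp only; omega

theorem corollary1 (K : Type u) [Field K] (n m : ℕ) (hmn : m < n) (α : Fin (m + 1) → ℕ)
    (hα : StrictMono α) (hα_zero : α 0 = 0) (hα_last : α (Fin.last m) = n)
    (loops : Set (Fin n)) (I : Ideal (MvPolynomial (Fin n) K))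
    (hI : I = (kPrimeGraph n m α loops).vertexCoverIdeal K)
    (hprincipal : ∃ s : Fin n →₀ ℕ, I = Ideal.span {MvPolynomial.monomial s (1 : K)}) :
    projectiveDimension (ModuleCat.of (MvPolynomial (Fin n) K) (MvPolynomial (Fin n) K ⧸ I)) = 1 ∧
    moduleDepth (gradedMaximalIdeal K n) (MvPolynomial (Fin n) K ⧸ I) = ((n - 1 : ℕ) : ℕ∞) ∧
    ringKrullDim (MvPolynomial (Fin n) K ⧸ I) = ((n - 1 : ℕ) : WithBot ℕ∞) ∧
    castelnuovoMumfordRegularity (K := K) (n := n) (MvPolynomial (Fin n) K ⧸ I)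
      (quotientGrading I) ≤ ((n - 1 : ℕ) : EReal) := by
  obtain ⟨s, hs⟩ := hprincipal
  obtain ⟨u, v, huv⟩ := exists_adj_kPrimeGraph n m hmn α hα hα_zero hα_last loops
  have hle : I ≤ gradedMaximalIdeal K n := hI ▸ vertexCoverIdeal_le_gradedMaximalIdeal K _ huv
  have hdeg : s.degree ≤ n := degree_le_of_vertexCoverIdeal_eq_span K _ s (hI.symm.trans hs)
  have hn : 0 < n := by omega
  have hne : (monomial s 1 : MvPolynomial (Fin n) K) ≠ 0 :=
    monomial_eq_zero.not.mpr one_ne_zero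
  subst hs
  have hmem : (monomial s 1 : MvPolynomial (Fin n) K) ∈ gradedMaximalIdeal K n :=
    hle (Ideal.mem_span_singleton_self _)
  exact ⟨projectiveDimension_quotient_span_singleton _ hne fun h =>
      gradedMaximalIdeal_ne_top K n (top_le_iff.mp (h ▸ hle)),
    moduleDepth_quotient_monomial K hn s hmem, ringKrullDim_quotient_monomial K hn s hmem,
    castelnuovoMumfordRegularity_hypersurface_le K hn _ s.degree hne
      (isHomogeneous_monomial 1 rfl) hmem hdeg⟩
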